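/- Let $p$ be a prime number and let $F$ be a field of characteristic different from $p$, with separable closure $F_{sep}$. For $m\ge 1$ let $\zeta_{p^m}\in F_{sep}$ be a primitive $p^m$-th root of unity, and let $\mu_{p^\infty}=\bigcup_{n\ge 1}\{z\in F_{sep} : z^{p^n}=1\}$. Let $CR(F)\subseteq F_{sep}$ be the compositum of the fields $F(\sqrt[p^m]{a},\zeta_{p^m})$, where $m$ runs over the integers $\ge 1$ and $a$ over $F^\times$. Suppose that $\mu_{p^\infty}\subseteq F$, and let $I$ be a set with $\#I=\dim_{\mathbb F_p}F^\times/(F^\times)^p$ (an equality of cardinal numbers, possibly infinite). Then $CR(F)/F$ is a Galois extension, and there are isomorphisms of topological groups \[ \mathrm{Gal}(CR(F)/F)\;\simeq\;\langle \tau_i,\ i\in I\mid [\tau_i,\tau_j]=1\ \text{for all } i,j\in I\rangle\;\simeq\;\prod_{i\in I}\mathbb Z_p . \] Here $\mathrm{Gal}(CR(F)/F)$ carries the Krull topology and $\prod_{i\in I}\mathbb Z_p$ the product topology. The middle group is presented as a pro-$p$ group: it is the quotient of the free pro-$p$ group $S$ on $\{\tau_i\}_{i\in I}$ by the closed normal subgroup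 generated by the commutators $[\tau_i,\tau_j]=\tau_i\tau_j\tau_i^{-1}\tau_j^{-1}$. The group $S$ is the inverse limit of the quotients $\Phi/N$, where $\Phi$ is the abstract free group on $\{\tau_i\}_{i\in I}$ and $N$ runs over the normal subgroups of $p$-power index that contain all but finitely many of the $\tau_i$. -/

import Mathlib

universe u v w

/-- The group `μ_{p^∞}` of all roots of unity of `p`-power order in a field `K`, as a subset of
`K`: the union over `n ≥ 1` of the sets of `p ^ n`-th roots of unity. -/
def muPInf (p : ℕ) (K : Type*) [Field K] : Set K :=
  {z : K | ∃ n : ℕ, 1 ≤ n ∧ z ^ p ^ n = 1}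

/-- The extension `F(a^{1/p^m}, ζ_{p^m})` of `F` inside `L`. All `p ^ m`-th roots of `a` are
adjoined: together with a primitive `p ^ m`-th root of unity this gives the same field as
adjoining a single one of them. -/
def radicalExt (p : ℕ) (F L : Type*) [Field F] [Field L] [Algebra F L] (a : Fˣ) (m : ℕ) :
    IntermediateField F L :=
  IntermediateField.adjoin F
    ({x : L | x ^ p ^ m = algebraMap F L a} ∪ {z : L | IsPrimitiveRoot z (p ^ m)})

/-- The `p`-cyclotomic radical extension `CR(F)` of `F` inside `L`: the compositum of the fields
`F(a^{1/p^m}, ζ_{p^m})` for `m ≥ 1` and `a ∈ Fˣ`. -/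
def cyclotomicRadicalExt (p : ℕ) (F L : Type*) [Field F] [Field L] [Algebra F L] :
    IntermediateField F L :=
  ⨆ (m : ℕ) (_ : 1 ≤ m) (a : Fˣ), radicalExt p F L a m

/-- The group `Fˣ / (Fˣ)^p` of `p`-th power classes, written additively. -/
def PowerClasses (p : ℕ) (F : Type*) [Field F] : Type _ :=
  Additive (Fˣ ⧸ (powMonoidHom p : Fˣ →* Fˣ).range)

instance PowerClasses.instAddCommGroup (p : ℕ) (F : Type*) [Field F] :
    AddCommGroup (PowerClasses p F) :=
  inferInstanceAs (AddCommGroup (Additive (Fˣ ⧸ (powMonoidHom p : Fˣ →* Fˣ).range)))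

theorem PowerClasses.nsmul_eq_zero (p : ℕ) (F : Type*) [Field F] (x : PowerClasses p F) :
    p • x = 0 := by
  have key : ∀ y : Fˣ ⧸ (powMonoidHom p : Fˣ →* Fˣ).range, y ^ p = 1 := by
    intro y
    induction y using QuotientGroup.induction_on with
    | H z =>
      rw [← QuotientGroup.mk_pow, QuotientGroup.eq_one_iff]
      exact ⟨z, rfl⟩
  exact key x

/-- `Fˣ / (Fˣ)^p` as a vector space over the field with `p` elements. -/
instance PowerClasses.instModule (p : ℕ) (F : Type*) [Field F] :
    Module (ZMod p) (PowerClasses p F) :=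
  AddCommGroup.zmodModule (PowerClasses.nsmul_eq_zero p F)

/-- The normal subgroups `N` of the free group on `X` of `p`-power index which contain all but
finitely many elements of `X`. -/
structure ProPKernel (p : ℕ) (X : Type*) where
  /-- The underlying subgroup. -/
  N : Subgroup (FreeGroup X)
  normal : N.Normal
  index_eq : ∃ k : ℕ, N.index = p ^ k
  cofinite : {x : X | FreeGroup.of x ∉ N}.Finite

instance {p : ℕ} {X : Type*} (N : ProPKernel p X) : N.N.Normal := N.normal

/-- The finite `p`-group `FreeGroup X ⧸ N`, with the discrete topology. -/
def ProPKernel.Quot {p : ℕ} {X : Type*} (N : ProPKernel p X) : Type _ := FreeGroup X ⧸ N.N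

instance {p : ℕ} {X : Type*} (N : ProPKernel p X) : Group N.Quot :=
  inferInstanceAs (Group (FreeGroup X ⧸ N.N))

instance {p : ℕ} {X : Type*} (N : ProPKernel p X) : TopologicalSpace N.Quot := ⊥

instance {p : ℕ} {X : Type*} (N : ProPKernel p X) : DiscreteTopology N.Quot := ⟨rfl⟩

/-- The projection `FreeGroup X → FreeGroup X ⧸ N`. -/
def ProPKernel.proj {p : ℕ} {X : Type*} (N : ProPKernel p X) : FreeGroup X →* N.Quot :=
  QuotientGroup.mk' N.N

/-- The projection `FreeGroup X ⧸ M → FreeGroup X ⧸ N` for `M ≤ N`. -/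
def ProPKernel.trans {p : ℕ} {X : Type*} {M N : ProPKernel p X} (h : M.N ≤ N.N) :
    M.Quot →* N.Quot :=
  QuotientGroup.map M.N N.N (MonoidHom.id _) h

/-- The free pro-`p` group on the set `X` (of generators converging to `1`): the inverse limit of
the groups `FreeGroup X ⧸ N`, over all normal subgroups `N` of `p`-power index which contain
almost all elements of `X`, inside their product. It carries the topology induced by the product
topology. -/
def FreeProP (p : ℕ) (X : Type*) : Subgroup (∀ N : ProPKernel p X, N.Quot) where
  carrier := {f | ∀ (M N : ProPKernel p X) (h : M.N ≤ N.N), ProPKernel.trans h (f M) = f N}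
  one_mem' := fun _ _ _ => map_one _
  mul_mem' := fun {f g} hf hg M N h => by
    rw [Pi.mul_apply, Pi.mul_apply, map_mul, hf M N h, hg M N h]
  inv_mem' := fun {f} hf M N h => by
    rw [Pi.inv_apply, Pi.inv_apply, map_inv, hf M N h]

/-- The generator of the free pro-`p` group on `X` given by `x : X`. -/
def FreeProP.of (p : ℕ) {X : Type*} (x : X) : FreeProP p X :=
  ⟨fun N => N.proj (FreeGroup.of x), fun _ _ _ => rfl⟩

instance {p : ℕ} {X : Type*} (R : Set (FreeProP p X)) :
    (Subgroup.normalClosure R).topologicalClosure.Normal :=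
  Subgroup.is_normal_topologicalClosure _

/-- The pro-`p` group `⟨X ∣ R⟩` with generating set `X` and set of relations `R`: the quotient of
the free pro-`p` group on `X` by the closed normal subgroup generated by `R`. -/
abbrev PresentedProP (p : ℕ) {X : Type*} (R : Set (FreeProP p X)) : Type _ :=
  FreeProP p X ⧸ (Subgroup.normalClosure R).topologicalClosure

/-- The relations `[τ_i, τ_j]`, for `i, j ∈ I`, in the free pro-`p` group on `τ_i`, `i ∈ I`. -/
def commutatorRelations (p : ℕ) (I : Type*) : Set (FreeProP p I) :=
  {r | ∃ i j : I,
    r = FreeProP.of p i * FreeProP.of p j * (FreeProP.of p i)⁻¹ * (FreeProP.of p j)⁻¹}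

/-! Both groups are compared with `∏ ℤ_p` by one criterion,
`nonempty_continuousMulEquiv_pi_padicInt`: a compact group is `ℤ_p ^ I` once it has continuous
characters `χ_i` to `ℤ_p`, jointly injective and linearly independent modulo `p`. The image of the
joint map is compact, hence closed, and independence modulo `p` makes it dense by successive
approximation (`PadicInt.eq_top_of_forall_linear_form`).

For the presented group, `χ_i` is the exponent of `τ_i`. The generators themselves show
independence. For injectivity, an element of `S` with all exponents zero dies in the abelianization
of every finite level, so at each level it is a product of commutators; hence it lies in the closure
of the normal subgroup they generate (`FreeProP.mem_topologicalClosure_of_exponent_eq_one`).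

For the Galois group, let `a_i` represent a basis of `Fˣ / (Fˣ)^p` and choose compatible roots `α_n`
of each `a_i`. Since `ζ_n ∈ F`, the rule `σ α_n = ζ_n ^ χ_i(σ) * α_n` defines a character. A
relation modulo `p` would put a product of `p`-th roots of the `a_i` in `F`, contradicting the
choice of basis. If all `χ_i(σ)` vanish, `σ` fixes the chosen roots, hence every `p`-power root of
every element of `Fˣ` (`fixes_roots_of_fixes_roots_of_basis`), and these generate `CR(F)`. -/

/-! ### Characters to `ℤ_p` and a criterion for powers of `ℤ_p`. -/

/-- A compatible family of homomorphisms to `ℤ / p ^ n` lifts to the `p`-adic integers. -/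
theorem PadicInt.exists_monoidHom_of_compatible {p : ℕ} [Fact p.Prime] {G : Type*} [Group G]
    (c : ∀ n, G →* Multiplicative (ZMod (p ^ n)))
    (hc : ∀ n g, ZMod.castHom (pow_dvd_pow p n.le_succ) (ZMod (p ^ n)) (c (n + 1) g).toAdd =
      (c n g).toAdd) :
    ∃ χ : G →* Multiplicative ℤ_[p],
      ∀ n g, PadicInt.toZModPow n (χ g).toAdd = (c n g).toAdd := by
  have key (g : G) : ∃ z : ℤ_[p], ∀ n, PadicInt.toZModPow n z = (c n g).toAdd := by
    have hdvd (n : ℕ) : (p : ℤ) ^ n ∣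
        (((c (n + 1) g).toAdd.val : ℕ) : ℤ) - (((c n g).toAdd.val : ℕ) : ℤ) := by
      have h := hc n g
      rw [← Nat.cast_pow, ← ZMod.intCast_eq_intCast_iff_dvd_sub]
      rw [Int.cast_natCast, Int.cast_natCast, ZMod.natCast_zmod_val, ← h, ZMod.castHom_apply,
        ZMod.natCast_val]
    refine ⟨_, fun n => (PadicInt.toZModPow_ofIntSeq_of_pow_dvd_sub
      (fun n => (((c n g).toAdd.val : ℕ) : ℤ)) p hdvd n).trans ?_⟩
    rw [Int.cast_natCast, ZMod.natCast_zmod_val]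
  choose z hz using key
  refine ⟨⟨⟨fun g => Multiplicative.ofAdd (z g), ?_⟩, ?_⟩, fun n g => hz g n⟩
  · refine congrArg Multiplicative.ofAdd (PadicInt.ext_of_toZModPow.mp fun n => ?_)
    simp [hz]
  · intro g h
    refine congrArg Multiplicative.ofAdd
      ((PadicInt.ext_of_toZModPow (x := z (g * h)) (y := z g + z h)).mp fun n => ?_)
    simp [hz]

theorem PadicInt.norm_le_pow_iff_toZModPow_eq_zero {p : ℕ} [Fact p.Prime] (x : ℤ_[p]) (n : ℕ) :
    ‖x‖ ≤ (p : ℝ) ^ (-n : ℤ) ↔ PadicInt.toZModPow n x = 0 := by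
  rw [PadicInt.norm_le_pow_iff_mem_span_pow, ← PadicInt.ker_toZModPow, RingHom.mem_ker]

/-- A homomorphism to `ℤ_p` is continuous if its reductions modulo `p ^ n` are. -/
theorem PadicInt.continuous_of_toZModPow {p : ℕ} [Fact p.Prime] {G : Type*} [Group G]
    [TopologicalSpace G] [IsTopologicalGroup G] (χ : G →* Multiplicative ℤ_[p])
    (h : ∀ n, ∀ᶠ g in nhds (1 : G), PadicInt.toZModPow n (χ g).toAdd = 0) : Continuous χ := by
  refine continuous_of_continuousAt_one χ ?_
  have : Filter.Tendsto (fun g => (χ g).toAdd) (nhds 1) (nhds (0 : ℤ_[p])) := by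
    rw [Metric.tendsto_nhds]
    intro ε hε
    obtain ⟨k, hk⟩ := PadicInt.exists_pow_neg_lt p hε
    filter_upwards [h k] with g hg
    rw [dist_zero_right]
    exact ((PadicInt.norm_le_pow_iff_toZModPow_eq_zero _ k).mpr hg).trans_lt hk
  rw [ContinuousAt, map_one]
  exact (continuous_ofAdd.tendsto (0 : ℤ_[p])).comp this

/-- A closed subgroup of `ℤ_p ^ I` is everything if no nonzero `𝔽_p`-linear form in finitely many
coordinates vanishes on it. -/
theorem PadicInt.eq_top_of_forall_linear_form {p : ℕ} [Fact p.Prime] {I : Type*}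
    (H : AddSubgroup (I → ℤ_[p])) (hH : IsClosed (H : Set (I → ℤ_[p])))
    (hform : ∀ (J : Finset I) (n : J → ZMod p), n ≠ 0 →
      ∃ h ∈ H, ∑ j : J, n j * PadicInt.toZMod (h j) ≠ 0) : H = ⊤ := by
  classical
  have mod_p (J : Finset I) (x : I → ℤ_[p]) :
      ∃ h ∈ H, ∀ j ∈ J, ∃ y : ℤ_[p], x j = h j + p * y := by
    let f : (I → ℤ_[p]) →+ (J → ZMod p) :=
      AddMonoidHom.pi fun j => (PadicInt.toZMod (p := p)).toAddMonoidHom.comp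
        (Pi.evalAddMonoidHom (fun _ : I => ℤ_[p]) (j : I))
    -- A proper subspace of `𝔽_p ^ J` is killed by a nonzero functional, against `hform`.
    have htop : AddSubgroup.toZModSubmodule p (H.map f) = ⊤ := by
      by_contra hne
      obtain ⟨φ, hφ0, hφ⟩ := Submodule.exists_le_ker_of_lt_top _ (lt_top_iff_ne_top.mpr hne)
      have hφ_eq (v : J → ZMod p) : φ v = ∑ j, φ (Pi.single j 1) * v j := by
        conv_lhs => rw [LinearMap.pi_apply_eq_sum_univ φ v]
        refine Finset.sum_congr rfl fun j _ => ?_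
        rw [smul_eq_mul, mul_comm]
        congr 2
        ext k
        simp [Pi.single_apply, eq_comm]
      obtain ⟨h, hhH, hh⟩ := hform J (fun j => φ (Pi.single j 1)) fun h0 => hφ0 <| by
        ext j
        simpa using congrFun h0 j
      refine hh ?_
      have : φ (f h) = 0 := hφ (show f h ∈ H.map f from ⟨h, hhH, rfl⟩)
      rwa [hφ_eq] at this
    have hx : f x ∈ AddSubgroup.toZModSubmodule p (H.map f) := htop ▸ Submodule.mem_top
    obtain ⟨h, hhH, hh⟩ : f x ∈ H.map f := hx
    refine ⟨h, hhH, fun j hj => ?_⟩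
    have h1 : PadicInt.toZMod (h j) = PadicInt.toZMod (x j) := congrFun hh ⟨j, hj⟩
    have h2 : x j - h j ∈ RingHom.ker (PadicInt.toZMod (p := p)) := by
      rw [RingHom.mem_ker, map_sub, h1, sub_self]
    rw [PadicInt.ker_toZMod, PadicInt.maximalIdeal_eq_span_p, Ideal.mem_span_singleton] at h2
    obtain ⟨y, hy⟩ := h2
    exact ⟨y, by rw [← hy]; ring⟩
  -- Successive approximation: the error `p ^ m * y` is improved by applying `mod_p` to `y`.
  have mod_pow (J : Finset I) (m : ℕ) (x : I → ℤ_[p]) :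
      ∃ h ∈ H, ∀ j ∈ J, ∃ y : ℤ_[p], x j = h j + p ^ m * y := by
    induction m with
    | zero => exact ⟨0, H.zero_mem, fun j _ => ⟨x j, by simp⟩⟩
    | succ m ih =>
      obtain ⟨h, hhH, hh⟩ := ih
      choose! y hy using hh
      obtain ⟨g, hgH, hg⟩ := mod_p J y
      refine ⟨h + p ^ m • g, H.add_mem hhH (H.nsmul_mem hgH _), fun j hj => ?_⟩
      obtain ⟨z, hz⟩ := hg j hj
      refine ⟨z, ?_⟩
      rw [hy j hj, hz]
      simp
      ring
  rw [eq_top_iff]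
  intro x _
  have hx : x ∈ closure (H : Set (I → ℤ_[p])) := by
    have hbasis := Filter.hasBasis_pi fun i => Metric.nhds_basis_ball (x := x i)
    rw [← nhds_pi] at hbasis
    rw [mem_closure_iff_nhds_basis hbasis]
    rintro ⟨S, ε⟩ ⟨hS, hε⟩
    have hk (i : I) : ∃ k : ℕ, i ∈ S → (p : ℝ) ^ (-(k : ℤ)) < ε i := by
      by_cases hi : i ∈ S
      · obtain ⟨k, hk⟩ := PadicInt.exists_pow_neg_lt p (hε i hi)
        exact ⟨k, fun _ => hk⟩
      · exact ⟨0, fun h => absurd h hi⟩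
    choose k hk using hk
    obtain ⟨h, hhH, hh⟩ := mod_pow hS.toFinset (hS.toFinset.sup k) x
    refine ⟨h, hhH, fun i hi => ?_⟩
    obtain ⟨y, hy⟩ := hh i (hS.mem_toFinset.mpr hi)
    obtain ⟨d, hd⟩ := Nat.exists_eq_add_of_le (Finset.le_sup (f := k) (hS.mem_toFinset.mpr hi))
    rw [mem_ball_iff_norm']
    refine lt_of_le_of_lt ?_ (hk i hi)
    rw [PadicInt.norm_le_pow_iff_mem_span_pow, Ideal.mem_span_singleton]
    exact ⟨p ^ d * y, by rw [hy, hd]; ring⟩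
  rwa [hH.closure_eq] at hx

open scoped commutatorElement

theorem ContinuousMulEquiv.nonempty_of_bijective {G H : Type*} [Group G] [Group H]
    [TopologicalSpace G] [TopologicalSpace H] [CompactSpace G] [T2Space H] (f : G →* H)
    (hf : Continuous f) (hbij : Function.Bijective f) : Nonempty (G ≃ₜ* H) :=
  ⟨{ MulEquiv.ofBijective f hbij with
      continuous_toFun := hf
      continuous_invFun :=
        (Continuous.homeoOfEquivCompactToT2 (f := Equiv.ofBijective f hbij) hf).symm.continuous }⟩

/-- A compact group with a jointly injective family of continuous homomorphisms to `ℤ_p`, whose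
reductions modulo `p` are linearly independent, is isomorphic to a power of `ℤ_p`. -/
theorem nonempty_continuousMulEquiv_pi_padicInt {p : ℕ} [Fact p.Prime] {G : Type*} [Group G]
    [TopologicalSpace G] [CompactSpace G] {I : Type*} (φ : I → G →* Multiplicative ℤ_[p])
    (hcont : ∀ i, Continuous (φ i)) (hinj : ∀ g, (∀ i, φ i g = 1) → g = 1)
    (hform : ∀ (J : Finset I) (n : J → ZMod p), n ≠ 0 →
      ∃ g, ∑ j : J, n j * PadicInt.toZMod (φ j g).toAdd ≠ 0) :
    Nonempty (G ≃ₜ* (I → Multiplicative ℤ_[p])) := by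
  let Φ : G →* (I → Multiplicative ℤ_[p]) := MonoidHom.pi φ
  have hΦ : Continuous Φ := continuous_pi hcont
  refine ContinuousMulEquiv.nonempty_of_bijective Φ hΦ
    ⟨(injective_iff_map_eq_one Φ).mpr fun g hg => hinj g fun i => congrFun hg i, ?_⟩
  let H : AddSubgroup (I → ℤ_[p]) :=
    { carrier := Set.range fun g i => (φ i g).toAdd
      zero_mem' := ⟨1, by ext; simp⟩
      add_mem' := by
        rintro _ _ ⟨g, rfl⟩ ⟨h, rfl⟩
        exact ⟨g * h, by ext; simp⟩
      neg_mem' := by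
        rintro _ ⟨g, rfl⟩
        exact ⟨g⁻¹, by ext; simp⟩ }
  have hH : IsClosed (H : Set (I → ℤ_[p])) :=
    (isCompact_range (f := fun g i => (φ i g).toAdd)
      (continuous_pi fun i => continuous_toAdd.comp (hcont i))).isClosed
  have htop := PadicInt.eq_top_of_forall_linear_form H hH fun J n hn => by
    obtain ⟨g, hg⟩ := hform J n hn
    exact ⟨_, ⟨g, rfl⟩, hg⟩
  intro x
  have hx : (fun i => (x i).toAdd) ∈ H := htop ▸ AddSubgroup.mem_top _
  obtain ⟨g, hg⟩ := hx
  exact ⟨g, funext fun i => Multiplicative.toAdd.injective (congrFun hg i)⟩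

/-! ### Free pro-`p` groups and their exponents. -/

/-- The kernel of a homomorphism from a free group to a finite `p`-group which kills all but
finitely many generators. -/
def ProPKernel.ker {p : ℕ} [Fact p.Prime] {X A : Type*} [Group A] (f : FreeGroup X →* A)
    (hA : ∃ k, Nat.card A = p ^ k) (hf : {x | f (FreeGroup.of x) ≠ 1}.Finite) :
    ProPKernel p X where
  N := f.ker
  normal := inferInstance
  index_eq := by
    obtain ⟨k, hk⟩ := hA
    rw [Subgroup.index_ker]
    have h := Subgroup.card_subgroup_dvd_card f.range
    rw [hk, Nat.dvd_prime_pow Fact.out] at h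
    obtain ⟨m, -, hm⟩ := h
    exact ⟨m, hm⟩
  cofinite := hf

namespace FreeProP

variable {p : ℕ} {X : Type*}

theorem isClosed : IsClosed (FreeProP p X : Set (∀ N : ProPKernel p X, N.Quot)) := by
  have : (FreeProP p X : Set (∀ N : ProPKernel p X, N.Quot)) =
      ⋂ (M : ProPKernel p X) (N : ProPKernel p X) (h : M.N ≤ N.N),
        {f | ProPKernel.trans h (f M) = f N} := by
    ext f
    simp only [Set.mem_iInter]
    rfl
  rw [this]
  exact isClosed_iInter fun M => isClosed_iInter fun N => isClosed_iInter fun h =>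
    isClosed_eq (continuous_of_discreteTopology.comp (continuous_apply M)) (continuous_apply N)

theorem finite_quot [Fact p.Prime] (N : ProPKernel p X) : Finite N.Quot := by
  obtain ⟨k, hk⟩ := N.index_eq
  have : N.N.FiniteIndex := ⟨by rw [hk]; exact (pow_pos (Fact.out : p.Prime).pos k).ne'⟩
  exact inferInstanceAs (Finite (FreeGroup X ⧸ N.N))

instance [Fact p.Prime] : CompactSpace (FreeProP p X) := by
  have := fun N : ProPKernel p X => finite_quot N
  exact isCompact_iff_compactSpace.mp isClosed.isCompact

theorem exists_eq_proj (s : FreeProP p X) (N : ProPKernel p X) : ∃ w, s.1 N = N.proj w := by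
  obtain ⟨w, hw⟩ := QuotientGroup.mk'_surjective N.N (s.1 N)
  exact ⟨w, hw.symm⟩

theorem eq_proj_of_le (s : FreeProP p X) {M N : ProPKernel p X} (h : M.N ≤ N.N)
    {w : FreeGroup X} (hw : s.1 M = M.proj w) : s.1 N = N.proj w := by
  rw [← s.2 M N h, hw]
  rfl

theorem proj_eq_one_iff (N : ProPKernel p X) (w : FreeGroup X) : N.proj w = 1 ↔ w ∈ N.N :=
  QuotientGroup.eq_one_iff w

/-- The homomorphism from the free pro-`p` group determined by a homomorphism from the free group to
a finite `p`-group. -/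
def lift [Fact p.Prime] {A : Type*} [Group A] (f : FreeGroup X →* A)
    (hA : ∃ k, Nat.card A = p ^ k) (hf : {x | f (FreeGroup.of x) ≠ 1}.Finite) :
    FreeProP p X →* A :=
  ((QuotientGroup.kerLift f).comp (Pi.evalMonoidHom (fun N : ProPKernel p X => N.Quot)
    (ProPKernel.ker f hA hf))).comp (FreeProP p X).subtype

section lift

variable [Fact p.Prime] {A : Type*} [Group A] (f : FreeGroup X →* A)
    (hA : ∃ k, Nat.card A = p ^ k) (hf : {x | f (FreeGroup.of x) ≠ 1}.Finite)

/-- Any level `M` inside the kernel will do, so several lifts can be evaluated on one common word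
`w`. -/
theorem lift_eq {s : FreeProP p X} {M : ProPKernel p X} (h : M.N ≤ f.ker) {w : FreeGroup X}
    (hw : s.1 M = M.proj w) : lift f hA hf s = f w := by
  have : s.1 (ProPKernel.ker f hA hf) = (ProPKernel.ker f hA hf).proj w := eq_proj_of_le s h hw
  change QuotientGroup.kerLift f (s.1 (ProPKernel.ker f hA hf)) = f w
  rw [this]
  rfl

theorem lift_of (x : X) : lift f hA hf (FreeProP.of p x) = f (FreeGroup.of x) :=
  lift_eq f hA hf (M := ProPKernel.ker f hA hf) le_rfl rfl

theorem eventually_lift_eq_one : ∀ᶠ s in nhds (1 : FreeProP p X), lift f hA hf s = 1 := by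
  let K := ProPKernel.ker f hA hf
  have hc : Continuous fun s : FreeProP p X => s.1 K :=
    (continuous_apply K).comp continuous_subtype_val
  have : ∀ᶠ s in nhds (1 : FreeProP p X), s.1 K = 1 :=
    hc.continuousAt.eventually ((isOpen_discrete {(1 : K.Quot)}).mem_nhds (Set.mem_singleton _))
  filter_upwards [this] with s hs
  exact (lift_eq f hA hf (M := K) (w := 1) le_rfl (by rw [hs, map_one])).trans (map_one f)

end lift

/-- The exponent of a generator in elements of the free group, modulo `p ^ n`. -/
def exponentMod (p : ℕ) {X : Type*} [DecidableEq X] (x : X) (n : ℕ) :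
    FreeGroup X →* Multiplicative (ZMod (p ^ n)) :=
  FreeGroup.lift fun y => Multiplicative.ofAdd (if y = x then 1 else 0)

section exponent

variable [DecidableEq X] (x : X)

theorem exponentMod_of (n : ℕ) (y : X) :
    exponentMod p x n (FreeGroup.of y) = Multiplicative.ofAdd (if y = x then 1 else 0) :=
  FreeGroup.lift_apply_of

theorem exponentMod_finite (n : ℕ) :
    {y | exponentMod p x n (FreeGroup.of y) ≠ 1}.Finite := by
  refine (Set.finite_singleton x).subset fun y hy => ?_
  by_contra h
  refine hy ?_
  rw [exponentMod_of, if_neg (by simpa using h), ofAdd_zero]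

theorem exponentMod_succ (n : ℕ) (w : FreeGroup X) :
    ZMod.castHom (pow_dvd_pow p n.le_succ) (ZMod (p ^ n)) (exponentMod p x (n + 1) w).toAdd =
      (exponentMod p x n w).toAdd := by
  have : (AddMonoidHom.toMultiplicative
      (ZMod.castHom (pow_dvd_pow p n.le_succ) (ZMod (p ^ n))).toAddMonoidHom).comp
      (exponentMod p x (n + 1)) = exponentMod p x n := by
    ext y
    simp only [MonoidHom.comp_apply, exponentMod_of]
    rcases eq_or_ne y x with h | h
    · simp only [if_pos h]
      exact congrArg Multiplicative.ofAdd (map_one (ZMod.castHom (pow_dvd_pow p n.le_succ) (ZMod (p ^ n))))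
    · simp only [if_neg h]
      exact congrArg Multiplicative.ofAdd (map_zero (ZMod.castHom (pow_dvd_pow p n.le_succ) (ZMod (p ^ n))))
  exact congrArg Multiplicative.toAdd (DFunLike.congr_fun this w)

variable [Fact p.Prime]

/-- The exponent of a generator in elements of the free pro-`p` group, modulo `p ^ n`. -/
def liftExponentMod (n : ℕ) : FreeProP p X →* Multiplicative (ZMod (p ^ n)) :=
  lift (exponentMod p x n) ⟨n, Nat.card_zmod _⟩ (exponentMod_finite x n)

/-- The exponent of a generator is a continuous homomorphism from the free pro-`p` group to
`ℤ_p`. -/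
theorem exists_exponent : ∃ φ : FreeProP p X →* Multiplicative ℤ_[p], Continuous φ ∧
    (∀ n s, PadicInt.toZModPow n (φ s).toAdd = (liftExponentMod x n s).toAdd) ∧
    ∀ y, φ (FreeProP.of p y) = Multiplicative.ofAdd (if y = x then 1 else 0) := by
  obtain ⟨φ, hφ⟩ := PadicInt.exists_monoidHom_of_compatible (p := p)
    (fun n => liftExponentMod (p := p) x n) fun n s => by
      let K := ProPKernel.ker (exponentMod p x (n + 1)) ⟨n + 1, Nat.card_zmod _⟩
        (exponentMod_finite x (n + 1))
      obtain ⟨w, hw⟩ := exists_eq_proj s K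
      -- The exponent modulo `p ^ (n + 1)` determines the one modulo `p ^ n`, so `w` computes both.
      have hle : K.N ≤ (exponentMod p x n).ker := fun v hv => by
        have hv' : exponentMod p x (n + 1) v = 1 := hv
        have := exponentMod_succ (p := p) x n v
        rw [hv', toAdd_one, map_zero] at this
        exact this.symm
      rw [liftExponentMod, lift_eq _ _ _ le_rfl hw, liftExponentMod, lift_eq _ _ _ hle hw,
        exponentMod_succ]
  refine ⟨φ, PadicInt.continuous_of_toZModPow φ fun n => ?_, hφ, fun y => ?_⟩
  · filter_upwards [eventually_lift_eq_one (exponentMod p x n) ⟨n, Nat.card_zmod _⟩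
      (exponentMod_finite x n)] with s hs
    rw [hφ, liftExponentMod, hs, toAdd_one]
  · refine Multiplicative.toAdd.injective (PadicInt.ext_of_toZModPow.mp fun n => ?_)
    rw [hφ, liftExponentMod, lift_of, exponentMod_of]
    split_ifs <;> simp

end exponent

/-- The canonical homomorphism from the free group to the free pro-`p` group. -/
def ofFreeGroup (p : ℕ) (X : Type*) : FreeGroup X →* FreeProP p X :=
  FreeGroup.lift (FreeProP.of p)

theorem ofFreeGroup_apply (w : FreeGroup X) (N : ProPKernel p X) :
    (ofFreeGroup p X w).1 N = N.proj w := by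
  have : ((Pi.evalMonoidHom (fun N : ProPKernel p X => N.Quot) N).comp
      (FreeProP p X).subtype).comp (ofFreeGroup p X) = N.proj := by
    ext x
    simp only [MonoidHom.comp_apply, ofFreeGroup, FreeGroup.lift_apply_of]
    rfl
  exact DFunLike.congr_fun this w

/-- Modulo the relations the generators commute, hence so do all words, by induction on both words.
No topological closure is needed here. -/
theorem ofFreeGroup_commutator_le :
    (commutator (FreeGroup X)).map (ofFreeGroup p X) ≤
      Subgroup.normalClosure (commutatorRelations p X) := by
  set R := Subgroup.normalClosure (commutatorRelations p X)
  let q : FreeGroup X →* FreeProP p X ⧸ R := (QuotientGroup.mk' R).comp (ofFreeGroup p X)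
  have hgen (x y : X) : Commute (q (FreeGroup.of x)) (q (FreeGroup.of y)) := by
    rw [← commutatorElement_eq_one_iff_commute, ← map_commutatorElement]
    change ((ofFreeGroup p X ⁅FreeGroup.of x, FreeGroup.of y⁆ : FreeProP p X) :
      FreeProP p X ⧸ R) = 1
    rw [QuotientGroup.eq_one_iff]
    refine Subgroup.subset_normalClosure ⟨x, y, ?_⟩
    simp only [commutatorElement_def, map_mul, map_inv, ofFreeGroup, FreeGroup.lift_apply_of]
  have hcent (v w : FreeGroup X) : Commute (q v) (q w) := by
    induction v using FreeGroup.induction_on with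
    | C1 => rw [map_one]; exact Commute.one_left _
    | of x =>
      induction w using FreeGroup.induction_on with
      | C1 => rw [map_one]; exact Commute.one_right _
      | of y => exact hgen x y
      | inv_of y h => rw [map_inv]; exact h.inv_right
      | mul a b ha hb => rw [map_mul]; exact ha.mul_right hb
    | inv_of y h => rw [map_inv]; exact h.inv_left
    | mul a b ha hb => rw [map_mul]; exact ha.mul_left hb
  rw [Subgroup.map_le_iff_le_comap, commutator_def, Subgroup.commutator_le]
  intro v _ w _
  rw [Subgroup.mem_comap, ← QuotientGroup.eq_one_iff]
  change q ⁅v, w⁆ = 1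
  rw [map_commutatorElement, commutatorElement_eq_one_iff_commute]
  exact hcent v w

/-- A homomorphism from the free group to an abelian `p`-group of order `p ^ n` kills every element
in which the exponents of the generators outside its kernel vanish modulo `p ^ n`. -/
theorem eq_one_of_exponentMod_eq_one [DecidableEq X] {A : Type*} [CommGroup A] {n : ℕ}
    (hA : Nat.card A = p ^ n) (f : FreeGroup X →* A) (J : Finset X)
    (hJ : ∀ x, x ∉ J → f (FreeGroup.of x) = 1) (w : FreeGroup X)
    (hw : ∀ x ∈ J, exponentMod p x n w = 1) : f w = 1 := by
  have hpow (a : A) :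
      zmultiplesHom (Additive A) (Additive.ofMul a) ((p ^ n : ℕ) : ℤ) = 0 := by
    rw [zmultiplesHom_apply, natCast_zsmul, ← ofMul_pow, ← hA, pow_card_eq_one', ofMul_one]
  let g (a : A) : Multiplicative (ZMod (p ^ n)) →* A :=
    AddMonoidHom.toMultiplicativeLeft (ZMod.lift (p ^ n) ⟨_, hpow a⟩)
  have hg (a : A) : g a (Multiplicative.ofAdd 1) = a := by
    have := ZMod.lift_coe (p ^ n) ⟨_, hpow a⟩ 1
    simp only [Int.cast_one] at this
    exact (congrArg Additive.toMul this).trans (by simp)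
  -- In an abelian target, `f w` is the product of the `f x` raised to the exponents of `x` in `w`;
  -- it suffices to check this on generators.
  have hf : f = ∏ x ∈ J, (g (f (FreeGroup.of x))).comp (exponentMod p x n) := by
    ext y
    rw [MonoidHom.finsetProd_apply]
    simp only [MonoidHom.comp_apply, exponentMod_of]
    by_cases hy : y ∈ J
    · rw [Finset.prod_eq_single_of_mem y hy fun x _ hxy => by
        rw [if_neg hxy.symm, ofAdd_zero, map_one], if_pos rfl, hg]
    · rw [hJ y hy]
      refine (Finset.prod_eq_one fun x hx => ?_).symm
      rw [if_neg (by rintro rfl; exact hy hx), ofAdd_zero, map_one]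
  rw [hf, MonoidHom.finsetProd_apply]
  refine Finset.prod_eq_one fun x hx => ?_
  rw [MonoidHom.comp_apply, hw x hx, map_one]

/-- A basic neighbourhood in the inverse limit constrains finitely many levels; a common refinement
reduces this to a single level. -/
theorem exists_proPKernel_le [Fact p.Prime] (T : Finset (ProPKernel p X)) :
    ∃ M : ProPKernel p X, ∀ N ∈ T, M.N ≤ N.N := by
  let f : FreeGroup X →* (∀ N : T, N.1.Quot) := MonoidHom.pi fun N => N.1.proj
  choose k hk using fun N : ProPKernel p X => N.index_eq
  have hcard : Nat.card (∀ N : T, N.1.Quot) = p ^ ∑ N : T, k N := by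
    rw [Nat.card_pi, ← Finset.prod_pow_eq_pow_sum]
    exact Finset.prod_congr rfl fun N _ => hk N
  have hf : {x | f (FreeGroup.of x) ≠ 1}.Finite := by
    refine (T.finite_toSet.biUnion fun N _ => N.cofinite).subset fun x hx => ?_
    obtain ⟨N, hN⟩ := Function.ne_iff.mp hx
    exact Set.mem_biUnion N.2 fun h => hN ((proj_eq_one_iff N.1 _).mpr h)
  exact ⟨ProPKernel.ker f ⟨_, hcard⟩ hf, fun N hN w hw =>
    (proj_eq_one_iff N w).mp (congrFun (MonoidHom.mem_ker.mp hw) ⟨N, hN⟩)⟩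

/-- The common kernel of the exponents lies in the closed normal subgroup generated by the
commutators of the generators. -/
theorem mem_topologicalClosure_of_exponent_eq_one [DecidableEq X] [Fact p.Prime]
    (s : FreeProP p X) (hs : ∀ x n, liftExponentMod x n s = 1) :
    s ∈ (Subgroup.normalClosure (commutatorRelations p X)).topologicalClosure := by
  have key (N : ProPKernel p X) :
      ∃ r ∈ Subgroup.normalClosure (commutatorRelations p X), r.1 N = s.1 N := by
    have := finite_quot N
    have hab : ∃ n, Nat.card (Abelianization N.Quot) = p ^ n := by
      obtain ⟨k, hk⟩ := N.index_eq
      have hd : Nat.card (Abelianization N.Quot) ∣ p ^ k := by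
        rw [← hk]
        exact Subgroup.card_quotient_dvd_card (commutator N.Quot)
      obtain ⟨m, -, hm⟩ := (Nat.dvd_prime_pow Fact.out).mp hd
      exact ⟨m, hm⟩
    let f : FreeGroup X →* Abelianization N.Quot := Abelianization.of.comp N.proj
    have hJ (x : X) (hx : x ∉ N.cofinite.toFinset) : f (FreeGroup.of x) = 1 := by
      have : FreeGroup.of x ∈ N.N := by simpa using hx
      rw [MonoidHom.comp_apply, (proj_eq_one_iff N _).mpr this, map_one]
    have hf : {x | f (FreeGroup.of x) ≠ 1}.Finite :=
      N.cofinite.toFinset.finite_toSet.subset fun x hx => by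
        by_contra h
        exact hx (hJ x h)
    obtain ⟨n, hn⟩ := hab
    let J := N.cofinite.toFinset
    -- `p ^ n` is the order of the abelianized level, so the exponents modulo `p ^ n` of the
    -- generators outside `N` determine `f`.
    let e : FreeGroup X →* (J → Multiplicative (ZMod (p ^ n))) :=
      MonoidHom.pi fun x => exponentMod p (x : X) n
    have hecard : ∃ k, Nat.card (J → Multiplicative (ZMod (p ^ n))) = p ^ k := by
      refine ⟨n * J.card, ?_⟩
      have h1 : Nat.card (Multiplicative (ZMod (p ^ n))) = p ^ n := Nat.card_zmod _
      rw [Nat.card_fun, h1, Nat.card_eq_fintype_card, Fintype.card_coe, pow_mul]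
    have he : {x | e (FreeGroup.of x) ≠ 1}.Finite := by
      refine J.finite_toSet.subset fun y hy => ?_
      by_contra h
      refine hy (funext fun x => ?_)
      change exponentMod p (x : X) n (FreeGroup.of y) = 1
      rw [exponentMod_of, if_neg (by rintro rfl; exact h x.2), ofAdd_zero]
    have hfe : e.ker ≤ f.ker := fun w hw =>
      eq_one_of_exponentMod_eq_one hn f J hJ w fun x hx => congrFun (MonoidHom.mem_ker.mp hw) ⟨x, hx⟩
    let K := ProPKernel.ker e hecard he
    obtain ⟨v, hv⟩ := exists_eq_proj s K
    have hve : e v = 1 := funext fun x => by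
      have hle : K.N ≤ (exponentMod p (x : X) n).ker := fun w hw =>
        congrFun (MonoidHom.mem_ker.mp hw) x
      have := hs x n
      rwa [liftExponentMod, lift_eq _ _ _ hle hv] at this
    have hsf : lift f ⟨n, hn⟩ hf s = 1 := (lift_eq f _ _ hfe hv).trans (hfe hve)
    obtain ⟨w, hw⟩ := exists_eq_proj s N
    have hNf : N.N ≤ f.ker := fun u hu => by
      rw [MonoidHom.mem_ker, MonoidHom.comp_apply, (proj_eq_one_iff N _).mpr hu, map_one]
    rw [lift_eq f _ _ hNf hw] at hsf
    have hcomm : N.proj w ∈ commutator N.Quot := by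
      rw [← Abelianization.ker_of]
      exact hsf
    have hsurj : Function.Surjective N.proj := QuotientGroup.mk'_surjective N.N
    rw [commutator_def, ← MonoidHom.range_eq_top.mpr hsurj, ← map_commutator_eq] at hcomm
    obtain ⟨c, hc, hcw⟩ := hcomm
    refine ⟨ofFreeGroup p X c, ofFreeGroup_commutator_le ⟨c, hc, rfl⟩, ?_⟩
    rw [ofFreeGroup_apply, hcw, hw]
  have hbasis := (Filter.hasBasis_pi_pure s.1).comap (Subtype.val : FreeProP p X → _)
  simp only [← nhds_discrete] at hbasis
  rw [← nhds_pi, ← nhds_subtype] at hbasis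
  refine (mem_closure_iff_nhds_basis hbasis).mpr fun T hT => ?_
  obtain ⟨M, hM⟩ := exists_proPKernel_le hT.toFinset
  obtain ⟨r, hr, hrs⟩ := key M
  refine ⟨r, hr, fun N hN => ?_⟩
  have hle := hM N (hT.mem_toFinset.mpr hN)
  rw [← r.2 M N hle, ← s.2 M N hle, hrs]

end FreeProP

theorem PresentedProP.nonempty_continuousMulEquiv_pi (p : ℕ) [Fact p.Prime] (I : Type*) :
    Nonempty (PresentedProP p (commutatorRelations p I) ≃ₜ* (I → Multiplicative ℤ_[p])) := by
  classical
  choose φ hφ hφ' hφ_of using FreeProP.exists_exponent (p := p) (X := I)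
  set R := (Subgroup.normalClosure (commutatorRelations p I)).topologicalClosure with hR
  have hker (i : I) : R ≤ (φ i).ker := by
    refine Subgroup.topologicalClosure_minimal _ (Subgroup.normalClosure_le_normal ?_)
      (isClosed_singleton.preimage (hφ i))
    rintro _ ⟨j, k, rfl⟩
    simp only [SetLike.mem_coe, MonoidHom.mem_ker, map_mul, map_inv]
    rw [mul_right_comm (φ i _), mul_inv_cancel, one_mul, mul_inv_cancel]
  refine nonempty_continuousMulEquiv_pi_padicInt
    (fun i => QuotientGroup.lift R (φ i) (hker i))
    (fun i => (hφ i).quotient_lift _) (fun g => ?_) fun J n hn => ?_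
  · induction g using QuotientGroup.induction_on with
    | H s =>
      intro hs
      rw [QuotientGroup.eq_one_iff]
      refine FreeProP.mem_topologicalClosure_of_exponent_eq_one s fun i m => ?_
      have h1 : φ i s = 1 := hs i
      refine Multiplicative.toAdd.injective ?_
      rw [← hφ' i m s, h1, toAdd_one, map_zero, toAdd_one]
  · obtain ⟨j, hj⟩ := Function.ne_iff.mp hn
    -- The exponents of `τ_j` are a Kronecker delta, so the form takes the value `n j ≠ 0` on it.
    refine ⟨(FreeProP.of p (j : I) : FreeProP p I), ?_⟩
    rw [Finset.sum_eq_single j]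
    · simpa [hφ_of] using hj
    · intro i _ hij
      have : (j : I) ≠ i := fun h => hij (Subtype.ext h.symm)
      simp [hφ_of, this]
    · exact fun h => absurd (Finset.mem_univ _) h

/-! ### Kummer theory over a field containing the `p`-power roots of unity. -/

theorem IsPrimitiveRoot.pow_eq_pow_iff_natCast_eq {F : Type*} [Field F] {ζ : F} {k : ℕ} (hk : k ≠ 0)
    (h : IsPrimitiveRoot ζ k) (a b : ℕ) : ζ ^ a = ζ ^ b ↔ (a : ZMod k) = b := by
  lift ζ to Fˣ using (h.ne_zero hk).isUnit
  rw [IsPrimitiveRoot.coe_units_iff] at h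
  rw [← Units.val_pow_eq_pow_val, ← Units.val_pow_eq_pow_val, Units.val_inj, pow_eq_pow_iff_modEq, ← h.eq_orderOf,
    ZMod.natCast_eq_natCast_iff]

theorem pow_pow_eq_of_forall_pow_eq {M : Type*} [Monoid M] {p : ℕ} {x : ℕ → M}
    (hx : ∀ n, x (n + 1) ^ p = x n) (n : ℕ) : x n ^ p ^ n = x 0 := by
  induction n with
  | zero => simp
  | succ n ih => rw [pow_succ', pow_mul, hx, ih]

/-- The action on `p`-th roots is read in `ZMod (p ^ 1)`, while the independence criterion uses
`ZMod p`. -/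
theorem PadicInt.natCast_val_toZModPow_one {p : ℕ} [Fact p.Prime] (z : ℤ_[p]) :
    ((PadicInt.toZModPow 1 z).val : ZMod p) = PadicInt.toZMod z := by
  have h : z - ((PadicInt.toZModPow 1 z).val : ℤ_[p]) ∈
      RingHom.ker (PadicInt.toZModPow (p := p) 1) := by
    rw [RingHom.mem_ker, map_sub, map_natCast, ZMod.natCast_zmod_val, sub_self]
  rw [PadicInt.ker_toZModPow, pow_one, ← PadicInt.maximalIdeal_eq_span_p, ← PadicInt.ker_toZMod,
    RingHom.mem_ker, map_sub, map_natCast, sub_eq_zero] at h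
  exact h.symm

/-- The class of a unit in `Fˣ / (Fˣ)^p`. -/
def PowerClasses.mk (p : ℕ) {F : Type*} [Field F] : Additive Fˣ →+ PowerClasses p F :=
  MonoidHom.toAdditive (QuotientGroup.mk' (powMonoidHom p : Fˣ →* Fˣ).range)

theorem PowerClasses.mk_surjective {p : ℕ} {F : Type*} [Field F] : Function.Surjective (PowerClasses.mk p (F := F)) :=
  QuotientGroup.mk'_surjective (powMonoidHom p : Fˣ →* Fˣ).range

theorem PowerClasses.mk_eq_zero_iff {p : ℕ} {F : Type*} [Field F] (a : Fˣ) :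
    PowerClasses.mk p (Additive.ofMul a) = 0 ↔ ∃ b : Fˣ, b ^ p = a :=
  QuotientGroup.eq_one_iff a

section Kummer

variable {p : ℕ} [Fact p.Prime] {F K : Type*} [Field F] [Field K] [Algebra F K]

/-- The Kummer character of a compatible system of `p`-power roots. -/
theorem exists_kummer_character [Algebra.IsAlgebraic F K] {ζ : ℕ → F}
    (hζ : ∀ n, IsPrimitiveRoot (ζ n) (p ^ n))
    (hζp : ∀ n, ζ (n + 1) ^ p = ζ n) {a : F} (ha : a ≠ 0) {α : ℕ → K}
    (hα0 : α 0 = algebraMap F K a) (hα : ∀ n, α (n + 1) ^ p = α n) :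
    ∃ χ : Gal(K/F) →* Multiplicative ℤ_[p], Continuous χ ∧ ∀ n σ,
      σ (α n) = algebraMap F K (ζ n) ^ (PadicInt.toZModPow n (χ σ).toAdd).val * α n := by
  have hpn (n : ℕ) : p ^ n ≠ 0 := pow_ne_zero n (Fact.out : p.Prime).ne_zero
  have hpow (n : ℕ) : α n ^ p ^ n = algebraMap F K a :=
    (pow_pow_eq_of_forall_pow_eq hα n).trans hα0
  have hne (n : ℕ) : α n ≠ 0 := fun h => by
    have := hpow n
    rw [h, zero_pow (hpn n)] at this
    exact ha ((algebraMap F K).injective (by rw [← this, map_zero]))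
  have hζ' (n : ℕ) : IsPrimitiveRoot (algebraMap F K (ζ n)) (p ^ n) :=
    (hζ n).map_of_injective (algebraMap F K).injective
  have hex (n : ℕ) (σ : Gal(K/F)) : ∃ i : ℕ, σ (α n) = algebraMap F K (ζ n) ^ i * α n := by
    have h1 : (σ (α n) / α n) ^ p ^ n = 1 := by
      rw [div_pow, ← map_pow, hpow, AlgEquiv.commutes, div_self]
      exact (map_ne_zero _).mpr ha
    have : NeZero (p ^ n) := ⟨hpn n⟩
    obtain ⟨i, -, hi⟩ := (hζ' n).eq_pow_of_pow_eq_one h1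
    exact ⟨i, by rw [hi, div_mul_cancel₀ _ (hne n)]⟩
  choose i hi using hex
  have uniq (n k l : ℕ) (h : algebraMap F K (ζ n) ^ k * α n = algebraMap F K (ζ n) ^ l * α n) :
      (k : ZMod (p ^ n)) = l := by
    have hM := mul_right_cancel₀ (hne n) h
    rw [← map_pow, ← map_pow] at hM
    exact ((hζ n).pow_eq_pow_iff_natCast_eq (hpn n) k l).mp ((algebraMap F K).injective hM)
  -- The cocycle `σ (α n) / α n` is a homomorphism because `σ` fixes `ζ n ∈ F`.
  let c (n : ℕ) : Gal(K/F) →* Multiplicative (ZMod (p ^ n)) :=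
    { toFun := fun σ => Multiplicative.ofAdd ((i n σ : ℕ) : ZMod (p ^ n))
      map_one' := by
        rw [uniq n (i n 1) 0 (by rw [← hi]; simp), Nat.cast_zero, ofAdd_zero]
      map_mul' := fun σ τ => by
        rw [← ofAdd_add, ← Nat.cast_add, uniq n (i n (σ * τ)) (i n σ + i n τ)]
        rw [← hi, AlgEquiv.mul_apply, hi n τ, map_mul, map_pow, AlgEquiv.commutes, hi n σ]
        ring }
  obtain ⟨χ, hχ⟩ := PadicInt.exists_monoidHom_of_compatible c fun n σ => by
    change ZMod.castHom _ _ ((i (n + 1) σ : ℕ) : ZMod (p ^ (n + 1))) = ((i n σ : ℕ) : ZMod (p ^ n))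
    rw [map_natCast]
    refine uniq n _ _ ?_
    rw [← hi, ← hα n, map_pow, hi (n + 1), ← hζp n, map_pow]
    ring
  refine ⟨χ, PadicInt.continuous_of_toZModPow χ fun n => ?_, fun n σ => ?_⟩
  -- `χ` modulo `p ^ n` vanishes on the open stabilizer of `α n`.
  · have hopen := stabilizer_isOpen_of_isIntegral (K := F) (α n)
    filter_upwards [hopen.mem_nhds (one_mem (MulAction.stabilizer Gal(K/F) (α n)))] with σ hσ
    have hσ' : σ (α n) = α n := hσ
    rw [hχ]
    have := uniq n (i n σ) 0 (by rw [← hi, hσ', pow_zero, one_mul])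
    rwa [Nat.cast_zero] at this
  · rw [hχ, hi n σ]
    congr 1
    rw [← map_pow, ← map_pow]
    congr 1
    exact ((hζ n).pow_eq_pow_iff_natCast_eq (hpn n) _ _).mpr (ZMod.natCast_zmod_val _).symm

theorem PowerClasses.exists_mem_closure {I : Type*} {a : I → Fˣ}
    (ha : ⊤ ≤ Submodule.span (ZMod p) (Set.range fun i => PowerClasses.mk p (Additive.ofMul (a i))))
    (x : Fˣ) : ∃ y ∈ Subgroup.closure (Set.range a), ∃ b : Fˣ, x = y * b ^ p := by
  have key (z : PowerClasses p F) : ∃ y ∈ Subgroup.closure (Set.range a),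
      PowerClasses.mk p (Additive.ofMul y) = z := by
    have hz := ha (Submodule.mem_top (x := z))
    induction hz using Submodule.span_induction with
    | mem z h =>
      obtain ⟨i, rfl⟩ := h
      exact ⟨a i, Subgroup.subset_closure ⟨i, rfl⟩, rfl⟩
    | zero => exact ⟨1, one_mem _, map_zero _⟩
    | add z w _ _ hz hw =>
      obtain ⟨y, hy, rfl⟩ := hz
      obtain ⟨y', hy', rfl⟩ := hw
      exact ⟨y * y', mul_mem hy hy', map_add _ _ _⟩
    | smul c z _ hz =>
      obtain ⟨y, hy, rfl⟩ := hz
      refine ⟨y ^ c.val, pow_mem hy _, ?_⟩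
      rw [ofMul_pow, map_nsmul, ← Nat.cast_smul_eq_nsmul (ZMod p), ZMod.natCast_zmod_val]
  obtain ⟨y, hy, hyx⟩ := key (PowerClasses.mk p (Additive.ofMul x))
  have : PowerClasses.mk p (Additive.ofMul (x / y)) = 0 := by
    rw [ofMul_div, map_sub, hyx, sub_self]
  obtain ⟨b, hb⟩ := (PowerClasses.mk_eq_zero_iff _).mp this
  exact ⟨y, hy, b, by rw [hb, mul_div_cancel]⟩

/-- If all `p`-power roots of elements of a basis of `Fˣ / (Fˣ)^p` have a root fixed by `σ`, then
`σ` fixes all `p`-power roots of elements of `Fˣ`. -/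
theorem fixes_roots_of_fixes_roots_of_basis {ζ : F} (hζ : IsPrimitiveRoot ζ p) {I : Type*}
    {a : I → Fˣ}
    (ha : ⊤ ≤ Submodule.span (ZMod p) (Set.range fun i => PowerClasses.mk p (Additive.ofMul (a i))))
    (σ : Gal(K/F)) (hσ : ∀ i m, ∃ y : K, y ^ p ^ m = algebraMap F K (a i) ∧ σ y = y)
    (m : ℕ) (x : K) (b : Fˣ) (hx : x ^ p ^ m = algebraMap F K b) : σ x = x := by
  have hclosure (y : Fˣ) (hy : y ∈ Subgroup.closure (Set.range a)) :
      ∀ m, ∃ z : K, z ^ p ^ m = algebraMap F K y ∧ σ z = z := by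
    induction hy using Subgroup.closure_induction with
    | mem y h =>
      obtain ⟨i, rfl⟩ := h
      exact hσ i
    | one => exact fun m => ⟨1, by simp, map_one σ⟩
    | mul y y' _ _ h h' =>
      intro m
      obtain ⟨z, hz, hz'⟩ := h m
      obtain ⟨w, hw, hw'⟩ := h' m
      exact ⟨z * w, by rw [mul_pow, hz, hw, Units.val_mul, map_mul], by rw [map_mul, hz', hw']⟩
    | inv y _ h =>
      intro m
      obtain ⟨z, hz, hz'⟩ := h m
      exact ⟨z⁻¹, by rw [inv_pow, hz, Units.val_inv_eq_inv_val, map_inv₀], by rw [map_inv₀, hz']⟩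
  have hp0 : p ≠ 0 := (Fact.out : p.Prime).ne_zero
  have : NeZero p := ⟨hp0⟩
  induction m generalizing x b with
  | zero => rw [pow_zero, pow_one] at hx; rw [hx, AlgEquiv.commutes]
  | succ m ih =>
    -- With `b = y * c ^ p` and `z` a fixed root of `y`, `(x / z) ^ p ^ m` is `c` times a `p`-th
    -- root of unity. It lies in `F`, so induction applies to `x / z`.
    obtain ⟨y, hy, c, rfl⟩ := PowerClasses.exists_mem_closure ha b
    obtain ⟨z, hz, hz'⟩ := hclosure y hy (m + 1)
    have hy0 : algebraMap F K y ≠ 0 := (map_ne_zero _).mpr y.ne_zero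
    have hc0 : algebraMap F K c ≠ 0 := (map_ne_zero _).mpr c.ne_zero
    have hz0 : z ≠ 0 := fun h => by
      rw [h, zero_pow (pow_ne_zero _ hp0)] at hz
      exact hy0 hz.symm
    have h1 : ((x / z) ^ p ^ m / algebraMap F K c) ^ p = 1 := by
      rw [div_pow, ← pow_mul, ← pow_succ, div_pow, hx, hz, Units.val_mul, Units.val_pow_eq_pow_val,
        map_mul, map_pow, mul_div_cancel_left₀ _ hy0, div_self (pow_ne_zero _ hc0)]
    obtain ⟨k, -, hk⟩ :=
      (hζ.map_of_injective (algebraMap F K).injective).eq_pow_of_pow_eq_one h1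
    have hζ0 : ζ ≠ 0 := hζ.ne_zero hp0
    have h2 := ih (x / z) (Units.mk0 ζ hζ0 ^ k * c) (by
      rw [Units.val_mul, Units.val_pow_eq_pow_val, Units.val_mk0, map_mul, map_pow, hk,
        div_mul_cancel₀ _ hc0])
    rw [map_div₀, hz'] at h2
    exact (div_left_inj' hz0).mp h2

/-- Kummer theory for the extension generated by all `p`-power roots, over a field which contains
all roots of unity of `p`-power order. -/
theorem nonempty_galois_continuousMulEquiv_pi [IsGalois F K] {ζ : ℕ → F}
    (hζ : ∀ n, IsPrimitiveRoot (ζ n) (p ^ n)) (hζp : ∀ n, ζ (n + 1) ^ p = ζ n)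
    (hroots : ∀ a : Fˣ, ∃ α : ℕ → K, α 0 = algebraMap F K a ∧ ∀ n, α (n + 1) ^ p = α n)
    (hK : ∀ σ : Gal(K/F), (∀ (m : ℕ) (x : K) (a : Fˣ), x ^ p ^ m = algebraMap F K a → σ x = x) →
      σ = 1)
    {I : Type*} (b : Module.Basis I (ZMod p) (PowerClasses p F)) :
    Nonempty (Gal(K/F) ≃ₜ* (I → Multiplicative ℤ_[p])) := by
  have ha (i : I) : ∃ a : Fˣ, PowerClasses.mk p (Additive.ofMul a) = b i :=
    PowerClasses.mk_surjective (b i)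
  choose a ha using ha
  choose α hα0 hα using fun i => hroots (a i)
  choose χ hχ hχα using fun i => exists_kummer_character hζ hζp (a i).ne_zero (hα0 i) (hα i)
  have hζ1 : IsPrimitiveRoot (ζ 1) p := by simpa using hζ 1
  refine nonempty_continuousMulEquiv_pi_padicInt χ hχ (fun σ hσ => hK σ ?_) fun J n hn => ?_
  · refine fixes_roots_of_fixes_roots_of_basis hζ1 (a := a) ?_ σ fun i m => ⟨α i m, ?_, ?_⟩
    · simp only [ha]
      exact b.span_eq.ge
    · rw [pow_pow_eq_of_forall_pow_eq (hα i), hα0]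
    · rw [hχα, hσ, toAdd_one, map_zero, ZMod.val_zero, pow_zero, one_mul]
  · by_contra! h
    -- `α j 1` is a `p`-th root of `a j`; the supposed relation makes `β` invariant, so `∏ a j ^ n
    -- j` is a `p`-th power in `F`.
    let β : K := ∏ j : J, α j 1 ^ (n j).val
    have hβ (σ : Gal(K/F)) : σ β = β := by
      let e : ℕ := ∑ j : J, (PadicInt.toZModPow 1 (χ j σ).toAdd).val * (n j).val
      have he : (e : ZMod p) = 0 := by
        rw [← h σ, Nat.cast_sum]
        refine Finset.sum_congr rfl fun j _ => ?_
        rw [Nat.cast_mul, PadicInt.natCast_val_toZModPow_one, ZMod.natCast_zmod_val, mul_comm]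
      have he1 : ζ 1 ^ e = 1 := by
        rw [hζ1.pow_eq_one_iff_dvd]
        exact (ZMod.natCast_eq_zero_iff _ _).mp he
      have : σ β = algebraMap F K (ζ 1) ^ e * β := by
        rw [map_prod, ← Finset.prod_pow_eq_pow_sum, ← Finset.prod_mul_distrib]
        refine Finset.prod_congr rfl fun j _ => ?_
        rw [map_pow, hχα, mul_pow, pow_mul]
      rw [this, ← map_pow, he1, map_one, one_mul]
    obtain ⟨c, hc⟩ := (InfiniteGalois.mem_range_algebraMap_iff_fixed β).mpr hβ
    have hcp : c ^ p = ((∏ j : J, a j ^ (n j).val : Fˣ) : F) := by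
      apply (algebraMap F K).injective
      rw [map_pow, hc, ← Finset.prod_pow, Units.coe_prod, map_prod]
      refine Finset.prod_congr rfl fun j _ => ?_
      rw [pow_right_comm, hα, hα0, Units.val_pow_eq_pow_val, map_pow]
    have hc0 : c ≠ 0 := fun h0 => by
      rw [h0, zero_pow (Fact.out : p.Prime).ne_zero] at hcp
      exact Units.ne_zero _ hcp.symm
    have hzero := (PowerClasses.mk_eq_zero_iff (p := p) _).mpr
      ⟨Units.mk0 c hc0, Units.ext (Eq.trans (Units.val_pow_eq_pow_val _ _) hcp)⟩
    rw [ofMul_prod, map_sum] at hzero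
    have hsum : ∑ j : J, n j • b j = 0 := by
      rw [← hzero]
      refine Finset.sum_congr rfl fun j _ => ?_
      rw [ofMul_pow, map_nsmul, ha, ← Nat.cast_smul_eq_nsmul (ZMod p), ZMod.natCast_zmod_val]
    have hlin := b.linearIndependent.comp (Subtype.val : J → I) Subtype.val_injective
    exact hn (funext fun j => Fintype.linearIndependent_iff.mp hlin n hsum j)

end Kummer

/-! ### The extension `CR(F)`. -/

section CyclotomicRadical

variable {p : ℕ} {F L : Type*} [Field F] [Field L] [Algebra F L]

/-- Roots of unity are roots of `a = 1`, so they need no separate generators. -/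
theorem cyclotomicRadicalExt_eq_adjoin :
    cyclotomicRadicalExt p F L = IntermediateField.adjoin F
      {x : L | ∃ m : ℕ, 1 ≤ m ∧ ∃ a : Fˣ, x ^ p ^ m = algebraMap F L a} := by
  refine le_antisymm ?_ (IntermediateField.adjoin_le_iff.mpr ?_)
  · refine iSup_le fun m => iSup_le fun hm => iSup_le fun a =>
      IntermediateField.adjoin.mono F _ _ ?_
    rintro x (hx | hx)
    · exact ⟨m, hm, a, hx⟩
    · exact ⟨m, hm, 1, by rw [IsPrimitiveRoot.pow_eq_one hx, Units.val_one, map_one]⟩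
  · rintro x ⟨m, hm, a, hx⟩
    have h : radicalExt p F L a m ≤ cyclotomicRadicalExt p F L :=
      le_iSup_of_le m (le_iSup_of_le hm (le_iSup_of_le a le_rfl))
    exact h (IntermediateField.subset_adjoin F _ (Or.inl hx))

/-- Embeddings over `F` preserve the set of generators, which gives normality; separability is
inherited from `L`. -/
theorem isGalois_cyclotomicRadicalExt [IsGalois F L] :
    IsGalois F (cyclotomicRadicalExt p F L) := by
  have hnormal : Normal F (cyclotomicRadicalExt p F L) := by
    rw [IntermediateField.normal_iff_forall_map_le]
    intro σ
    rw [cyclotomicRadicalExt_eq_adjoin, IntermediateField.adjoin_map]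
    refine IntermediateField.adjoin.mono F _ _ ?_
    rintro _ ⟨x, ⟨m, hm, a, hx⟩, rfl⟩
    refine ⟨m, hm, a, ?_⟩
    rw [← map_pow, hx, AlgHom.commutes]
  exact ⟨⟩

theorem mem_cyclotomicRadicalExt_of_pow_eq {x : L} {m : ℕ} {a : Fˣ}
    (hx : x ^ p ^ m = algebraMap F L a) : x ∈ cyclotomicRadicalExt p F L := by
  rw [cyclotomicRadicalExt_eq_adjoin]
  -- Generators need exponent at least `1`, and `m` may be `0`; hence `m + 1` and `a ^ p`.
  refine IntermediateField.subset_adjoin F _ ⟨m + 1, m.succ_pos, a ^ p, ?_⟩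
  rw [pow_succ, pow_mul, hx, Units.val_pow_eq_pow_val, map_pow]

theorem exists_seq_pow_eq [IsSepClosed L] (hp : (p : L) ≠ 0) (x : L) :
    ∃ α : ℕ → L, α 0 = x ∧ ∀ n, α (n + 1) ^ p = α n := by
  have : NeZero (p : L) := ⟨hp⟩
  choose r hr using fun y : L => IsSepClosed.exists_pow_nat_eq y p
  exact ⟨fun n => r^[n] x, rfl, fun n => by beta_reduce; rw [Function.iterate_succ_apply', hr]⟩

theorem exists_seq_isPrimitiveRoot [Fact p.Prime] [IsSepClosed L] (hp : (p : L) ≠ 0) :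
    ∃ ζ : ℕ → L, (∀ n, IsPrimitiveRoot (ζ n) (p ^ n)) ∧ ∀ n, ζ (n + 1) ^ p = ζ n := by
  have : NeZero (p : L) := ⟨hp⟩
  obtain ⟨ξ, hξ⟩ := HasEnoughRootsOfUnity.exists_primitiveRoot L p
  obtain ⟨α, hα0, hα⟩ := exists_seq_pow_eq hp ξ
  -- `α 0` already has order `p`; taking `p`-th powers shifts the sequence to start at `1`.
  refine ⟨fun n => α n ^ p, fun n => ?_, fun n => congrArg (· ^ p) (hα n)⟩
  have h (m : ℕ) : (α m ^ p) ^ p ^ m = 1 := by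
    rw [pow_right_comm, pow_pow_eq_of_forall_pow_eq hα, hα0, hξ.pow_eq_one]
  rw [IsPrimitiveRoot.iff_orderOf]
  rcases n with _ | n
  · simpa using h 0
  · refine orderOf_eq_prime_pow (fun h1 => ?_) (h (n + 1))
    beta_reduce at h1
    rw [hα, pow_pow_eq_of_forall_pow_eq hα, hα0] at h1
    exact hξ.ne_one (Fact.out : p.Prime).one_lt h1

theorem nonempty_galois_cyclotomicRadicalExt_equiv [Fact p.Prime] [IsSepClosure F L] (hp : (p : F) ≠ 0)
    (hmu : muPInf p L ⊆ Set.range (algebraMap F L)) {I : Type*}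
    (b : Module.Basis I (ZMod p) (PowerClasses p F)) :
    Nonempty (Gal(cyclotomicRadicalExt p F L/F) ≃ₜ* (I → Multiplicative ℤ_[p])) := by
  have : IsSepClosed L := IsSepClosure.sep_closed F
  have : IsGalois F (cyclotomicRadicalExt p F L) := isGalois_cyclotomicRadicalExt
  have hpL : (p : L) ≠ 0 := by
    rw [← map_natCast (algebraMap F L)]
    exact (map_ne_zero _).mpr hp
  have hinj := (algebraMap F L).injective
  obtain ⟨ξ, hξ, hξp⟩ := exists_seq_isPrimitiveRoot (p := p) hpL
  have hξF (n : ℕ) : ξ n ∈ Set.range (algebraMap F L) :=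
    hmu ⟨n + 1, n.succ_pos, by rw [pow_succ, pow_mul, (hξ n).pow_eq_one, one_pow]⟩
  choose ζ hζ using hξF
  refine nonempty_galois_continuousMulEquiv_pi (ζ := ζ)
    (fun n => IsPrimitiveRoot.of_map_of_injective (f := algebraMap F L) (hζ n ▸ hξ n) hinj)
    (fun n => hinj (by rw [map_pow, hζ, hζ, hξp])) (fun a => ?_) (fun σ hσ => ?_) b
  · obtain ⟨α, hα0, hα⟩ := exists_seq_pow_eq hpL (algebraMap F L a)
    have hmem (n : ℕ) : α n ∈ cyclotomicRadicalExt p F L :=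
      mem_cyclotomicRadicalExt_of_pow_eq ((pow_pow_eq_of_forall_pow_eq hα n).trans hα0)
    exact ⟨fun n => ⟨α n, hmem n⟩, Subtype.ext hα0, fun n => Subtype.ext (hα n)⟩
  · have : (σ : cyclotomicRadicalExt p F L →ₐ[F] cyclotomicRadicalExt p F L) = AlgHom.id F _ := by
      refine IntermediateField.algHom_ext_of_eq_adjoin _ cyclotomicRadicalExt_eq_adjoin ?_
      rintro x ⟨m, -, a, hx⟩
      exact hσ m _ a (Subtype.ext hx)
    exact AlgEquiv.ext fun x => DFunLike.congr_fun this x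

end CyclotomicRadical

theorem theorem4p1 (p : ℕ) [Fact p.Prime]
    (F : Type u) [Field F] (Fsep : Type v) [Field Fsep] [Algebra F Fsep] [IsSepClosure F Fsep]
    (hp : (p : F) ≠ 0)
    (hmu : muPInf p Fsep ⊆ Set.range (algebraMap F Fsep))
    (I : Type w)
    (hI : Cardinal.lift.{u} (Cardinal.mk I) =
      Cardinal.lift.{w} (Module.rank (ZMod p) (PowerClasses p F))) :
    IsGalois F (cyclotomicRadicalExt p F Fsep) ∧
    Nonempty (Gal(cyclotomicRadicalExt p F Fsep/F) ≃ₜ*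
      PresentedProP p (commutatorRelations p I)) ∧
    Nonempty (PresentedProP p (commutatorRelations p I) ≃ₜ*
      (I → Multiplicative ℤ_[p])) := by
  have : IsGalois F Fsep := inferInstance
  let b := Module.Basis.ofVectorSpace (ZMod p) (PowerClasses p F)
  rw [← b.mk_eq_rank''] at hI
  obtain ⟨e⟩ := Cardinal.lift_mk_eq'.mp hI
  obtain ⟨f⟩ := nonempty_galois_cyclotomicRadicalExt_equiv hp hmu (b.reindex e.symm)
  obtain ⟨g⟩ := PresentedProP.nonempty_continuousMulEquiv_pi p I
  exact ⟨isGalois_cyclotomicRadicalExt, ⟨f.trans g.symm⟩, ⟨g⟩⟩
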